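/- **Conventions.** A graph on a vertex set $V$ is a set of ordered pairs of vertices; $a\to b$ is a directed edge of $G$ if $(a,b)\in G$ and $(b,a)\notin G$, and $a-b$ is an undirected edge if both pairs are in $G$. $Dir(G)$ is the set of directed edges of $G$. The chain components of $G$ are the (vertex sets of the) connected components of the graph left after removing all directed edges. For $C\subseteq V$, $D[C]$ is the induced subgraph. Let $D$ be a DAG on a finite set $V$ of random variables, and $\mathcal I$ a family of intervention targets $J\subseteq V$. A system of joint distributions $(P_J)_{J\in\mathcal I\cup\{\emptyset\}}$ (of variables with finite ranges) can arise from $D$ under $\mathcal I$ if there are conditional probability tables $\theta_a(\cdot\mid x_{pa_D(a)})$, $a\in V$, and, for each $J$, marginal distributions $u_{J,a}$, $a\in J$, with $$P_J(x)=\prod_{a\notin J}\theta_a(x_a\mid x_{pa_D(a)})\prod_{a\in J}u_{J,a}(x_a)\qquad (J\in\mathcal I\cup\{\emptyset\}).$$ DAGs $D_1,D_2$ are $\mathcal I$-Markov equivalent if they are statistically indistinguishable under $\mathcal I$: for all finite ranges of the variables, the same systems of observational and interventional distributions can arise from $D_1$ and from $D_2$. The $\mathcal I$-essential graph $\mathcal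 E_{\mathcal I}(D)$ is the union of the edge sets of all DAGs that are $\mathcal I$-Markov equivalent to $D$; for $\mathcal I=\emptyset$ it is the observational essential graph of $D$. **Lemma.** Let $G$ be an undirected chordal graph on a finite vertex set $V$, let $D$ be a DAG in the Markov equivalence class corresponding to $G$ (that is, $\mathcal E_{\emptyset}(D)=G$), and let $v_1,\dots,v_k\in V$, $k\ge 1$. For a chain component $C$ of $\mathcal E_{\{\{v_1\}\}}(D)$, let $v^C_1,\dots,v^C_{m_C}$ (possibly none) be those of $v_1,\dots,v_k$ that lie in $C$. Then $$Dir\bigl(\mathcal E_{\{\{v_1\},\dots,\{v_k\}\}}(D)\bigr)=Dir\bigl(\mathcal E_{\{\{v_1\}\}}(D)\bigr)\;\cup\;\bigcup_{C}Dir\bigl(\mathcal E_{\{\{v^C_1\},\dots,\{v^C_{m_C}\}\}}(D[C])\bigr),$$ where $C$ runs over all chain components of $\mathcal E_{\{\{v_1\}\}}(D)$. -/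

import Mathlib

namespace CausalDAG

/-- The set of directed edges of a graph: the pairs `(a, b)` that are an edge while `(b, a)` is not.
A graph with vertex set `V` is its set of ordered edges, that is, a `Digraph V`; an undirected edge
between `a` and `b` is present as both `(a, b)` and `(b, a)`. -/
def Dir {V : Type*} (G : Digraph V) : Set (V × V) :=
  {e | G.Adj e.1 e.2 ∧ ¬ G.Adj e.2 e.1}

/-- An undirected graph, seen as a graph all of whose edges are undirected. -/
def ofUndirected {V : Type*} (G : SimpleGraph V) : Digraph V where
  Adj := G.Adj

/-- An undirected graph is chordal if for every cycle of length at least four there is an edge that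
is not part of the cycle but joins two of its vertices. -/
def IsChordal {V : Type*} (G : SimpleGraph V) : Prop :=
  ∀ (a : V) (c : G.Walk a a), c.IsCycle → 4 ≤ c.length →
    ∃ x ∈ c.support, ∃ y ∈ c.support, G.Adj x y ∧ s(x, y) ∉ c.edges

/-- A directed acyclic graph: no vertex reaches itself along one or more edges. -/
def IsDAG {V : Type*} (D : Digraph V) : Prop :=
  ∀ a : V, ¬ Relation.TransGen D.Adj a a

/-- The induced subgraph on a set of vertices. -/
def induced {V : Type*} (D : Digraph V) (C : Set V) : Digraph C where
  Adj a b := D.Adj a b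

/-- The vertex sets of the chain components of a graph: the connected components of what is left
after all directed edges are removed (`toSimpleGraphStrict` keeps the undirected edges). -/
def chainComponents {V : Type*} (G : Digraph V) : Set (Set V) :=
  Set.range (SimpleGraph.ConnectedComponent.supp (G := G.toSimpleGraphStrict))

/-- `θ` is a system of conditional probability tables for `D`: for each vertex `a`,
`θ a x s` is the probability that variable `a` takes the value `s` given that its parents take their
values in the configuration `x`; it does not depend on the other entries of `x`. -/
structure IsCPT {V : Type*} (D : Digraph V) {S : V → Type} (θ : ∀ a, (∀ b, S b) → S a → ℝ) :
    Prop where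
  nonneg : ∀ a x s, 0 ≤ θ a x s
  sum_eq_one : ∀ a x, ∑ᶠ s, θ a x s = 1
  parents : ∀ a x y, (∀ b, D.Adj b a → x b = y b) → θ a x = θ a y

/-- `u` assigns to each variable a probability distribution on its values. -/
structure IsMarginals {V : Type*} {S : V → Type} (u : ∀ a, S a → ℝ) : Prop where
  nonneg : ∀ a s, 0 ≤ u a s
  sum_eq_one : ∀ a, ∑ᶠ s, u a s = 1

open Classical in
/-- The joint distribution (as a mass function) after an intervention on the variables in `J`, which
are made independent of their parents, with the distributions `u`; every other variable
keeps its conditional distribution given its parents. For `J = ∅` it is the observational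
distribution. -/
noncomputable def interventional {V : Type*} {S : V → Type} (θ : ∀ a, (∀ b, S b) → S a → ℝ)
    (J : Set V) (u : ∀ a, S a → ℝ) (x : ∀ a, S a) : ℝ :=
  ∏ᶠ a, if a ∈ J then u a (x a) else θ a x (x a)

/-- The interventional model of `D` under the family `I` of targets, for variables with values in
`S`: all the systems of an observational distribution `P ∅` and interventional distributions
`P J`, `J ∈ I`, that can arise from `D`, with the same conditional distributions given the parents
throughout (the values of `P` at other sets are irrelevant). -/
def interventionalModel {V : Type*} (S : V → Type) (I : Set (Set V)) (D : Digraph V) :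
    Set (Set V → (∀ a, S a) → ℝ) :=
  {P | ∃ θ : ∀ a, (∀ b, S b) → S a → ℝ, IsCPT D θ ∧
    ∀ J ∈ insert ∅ I, ∃ u : ∀ a, S a → ℝ, IsMarginals u ∧ P J = interventional θ J u}

/-- Two DAGs are `I`-Markov equivalent if they are statistically indistinguishable under the targets
in `I`: whatever the (finite) ranges of the variables, exactly the same systems of observational and
interventional distributions can arise from them. For `I = ∅` this is Markov equivalence. -/
def MarkovEquiv {V : Type*} (I : Set (Set V)) (D₁ D₂ : Digraph V) : Prop :=
  ∀ (S : V → Type) [∀ a, Finite (S a)] [∀ a, Nonempty (S a)],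
    interventionalModel S I D₁ = interventionalModel S I D₂

/-- The `I`-essential graph of `D`: the union of all the DAGs that are `I`-Markov equivalent to `D`.
For `I = ∅` it is the essential graph of `D`. -/
def essentialGraph {V : Type*} (I : Set (Set V)) (D : Digraph V) : Digraph V :=
  sSup {D' | IsDAG D' ∧ MarkovEquiv I D D'}

end CausalDAG

namespace CausalDAG

variable {V : Type*}

/-! ### Markov equivalence determines the supports of distributions -/

/-! The essential graph of `D` is undirected, so `D` is moral: it has no unshielded collider. Moral
DAGs are equivalent under singleton targets exactly when they have the same skeleton and the same
edges leaving the targets.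

Necessity (`MarkovEquiv.adj_or_adj`, `MarkovEquiv.adj_of_target`, `MarkovEquiv.collider`) is read
off from supports: a vertex that is a deterministic function of its parents produces a support that
a DAG violating the condition cannot have. Sufficiency (`Moral.markovEquiv`) connects the two DAGs
by reversals of covered edges that touch no target, each of which preserves the model by Bayes'
formula.

An edge of `D` is directed in the essential graph iff no equivalent DAG reverses it. A DAG
equivalent to `D` under all targets is also equivalent under the first one alone, and by the
criterion its restriction to a chain component `C` is equivalent to `D[C]`; this gives one
inclusion. For the other, an edge that the first target leaves undirected lies in some `C`. A DAG
equivalent to `D[C]` that reverses it can be glued into `D`: all vertices of `C` have the same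
parents outside `C` (`adj_of_mem_chainComponents`), so edges covered inside `C` are covered in the
whole graph, and the gluing is equivalent to `D` (`Moral.markovEquiv_glue`). -/

lemma interventional_ne_zero [Finite V] {S : V → Type} (θ : ∀ a, (∀ b, S b) → S a → ℝ)
    (J : Set V) (u : ∀ a, S a → ℝ) (x : ∀ a, S a) :
    interventional θ J u x ≠ 0 ↔
      (∀ a ∈ J, u a (x a) ≠ 0) ∧ ∀ a ∉ J, θ a x (x a) ≠ 0 := by
  classical
  cases nonempty_fintype V
  unfold interventional
  rw [finprod_eq_prod_of_fintype, Finset.prod_ne_zero_iff]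
  constructor
  · intro h
    refine ⟨fun a ha => ?_, fun a ha => ?_⟩
    · simpa [ha] using h a (Finset.mem_univ a)
    · simpa [ha] using h a (Finset.mem_univ a)
  · rintro ⟨h1, h2⟩ a -
    by_cases ha : a ∈ J
    · simpa [ha] using h1 a ha
    · simpa [ha] using h2 a ha

lemma exists_isMarginals (S : V → Type) [∀ a, Finite (S a)] [∀ a, Nonempty (S a)] :
    ∃ u : ∀ a, S a → ℝ, IsMarginals u := by
  classical
  refine ⟨fun a s => if s = Classical.arbitrary (S a) then 1 else 0, ⟨fun a s => ?_, fun a => ?_⟩⟩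
  · split_ifs <;> norm_num
  · cases nonempty_fintype (S a)
    rw [finsum_eq_sum_of_fintype]
    simp

/-- A conditional probability table of one of two equivalent DAGs, with a choice of intervention
distributions, is matched by the other one. -/
lemma MarkovEquiv.exists_cpt {I : Set (Set V)} {D₁ D₂ : Digraph V} (h : MarkovEquiv I D₁ D₂)
    {S : V → Type} [∀ a, Finite (S a)] [∀ a, Nonempty (S a)]
    {θ : ∀ a, (∀ b, S b) → S a → ℝ} (hθ : IsCPT D₁ θ) {u : ∀ a, S a → ℝ} (hu : IsMarginals u) :
    ∃ θ' : ∀ a, (∀ b, S b) → S a → ℝ, IsCPT D₂ θ' ∧ ∀ J ∈ insert ∅ I,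
      ∃ u' : ∀ a, S a → ℝ, IsMarginals u' ∧ interventional θ J u = interventional θ' J u' := by
  have hP : (fun J => interventional θ J u) ∈ interventionalModel S I D₁ :=
    ⟨θ, hθ, fun J _ => ⟨u, hu, rfl⟩⟩
  rw [h S] at hP
  exact hP

lemma MarkovEquiv.refl (I : Set (Set V)) (D : Digraph V) : MarkovEquiv I D D :=
  fun _ _ _ => rfl

lemma MarkovEquiv.symm {I : Set (Set V)} {D₁ D₂ : Digraph V} (h : MarkovEquiv I D₁ D₂) :
    MarkovEquiv I D₂ D₁ :=
  fun S _ _ => (h S).symm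

lemma MarkovEquiv.trans {I : Set (Set V)} {D₁ D₂ D₃ : Digraph V} (h : MarkovEquiv I D₁ D₂)
    (h' : MarkovEquiv I D₂ D₃) : MarkovEquiv I D₁ D₃ :=
  fun S _ _ => (h S).trans (h' S)

lemma MarkovEquiv.mono {I I' : Set (Set V)} (hI : I ⊆ I') {D₁ D₂ : Digraph V}
    (h : MarkovEquiv I' D₁ D₂) : MarkovEquiv I D₁ D₂ := by
  classical
  have key : ∀ {D₁ D₂ : Digraph V}, MarkovEquiv I' D₁ D₂ →
      ∀ (S : V → Type) [∀ a, Finite (S a)] [∀ a, Nonempty (S a)],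
        interventionalModel S I D₁ ⊆ interventionalModel S I D₂ := by
    rintro D₁ D₂ h S _ _ P ⟨θ, hθ, hP⟩
    obtain ⟨u₀, hu₀⟩ := exists_isMarginals S
    -- To use the hypothesis for `I'`, the system is completed at the additional targets by
    -- interventions with arbitrary marginals.
    have hP' : (fun J => if J ∈ insert ∅ I then P J else interventional θ J u₀) ∈
        interventionalModel S I' D₁ := by
      refine ⟨θ, hθ, fun J _ => ?_⟩
      by_cases hJ : J ∈ insert ∅ I
      · simpa only [hJ, if_true] using hP J hJ
      · exact ⟨u₀, hu₀, by simp only [hJ, if_false]⟩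
    rw [h S] at hP'
    obtain ⟨θ', hθ', h'⟩ := hP'
    refine ⟨θ', hθ', fun J hJ => ?_⟩
    obtain ⟨u, hu, hJu⟩ := h' J (Set.insert_subset_insert hI hJ)
    exact ⟨u, hu, by simpa only [hJ, if_true] using hJu⟩
  exact fun S _ _ => (key h S).antisymm (key h.symm S)

/-- The range `Bool` for the vertices in `T`, and a one-point range for the others. -/
abbrev BinRange (T : Set V) (a : V) : Type := {s : Bool // s = true → a ∈ T}

instance (T : Set V) (a : V) : Nonempty (BinRange T a) := ⟨⟨false, by simp⟩⟩

open Classical in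
/-- The configuration with value `true` at the vertices in `A ∩ T`. -/
noncomputable def binConfig (T A : Set V) (a : V) : BinRange T a :=
  ⟨decide (a ∈ A ∧ a ∈ T), fun h => (of_decide_eq_true h).2⟩

lemma binConfig_congr {T A B : Set V} {a : V} (h : a ∈ T → (a ∈ A ↔ a ∈ B)) :
    binConfig T A a = binConfig T B a := by
  apply Subtype.ext
  simp only [binConfig, decide_eq_decide]
  tauto

lemma IsCPT.binRange_ne_zero {T : Set V} {D : Digraph V}
    {θ : ∀ a, (∀ b, BinRange T b) → BinRange T a → ℝ} (hθ : IsCPT D θ) {a : V} (ha : a ∉ T)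
    (x : ∀ b, BinRange T b) (s : BinRange T a) : θ a x s ≠ 0 := by
  have h0 : ∀ t : BinRange T a, t = s := fun t => by
    have h1 : ∀ t : BinRange T a, t.1 = false := fun t => by
      by_contra h
      exact ha (t.2 (by simpa using h))
    exact Subtype.ext ((h1 t).trans (h1 s).symm)
  have := hθ.sum_eq_one a x
  intro h
  have h2 : (fun s => θ a x s) = fun _ => 0 := funext fun t => by rw [h0 t, h]
  rw [h2] at this
  simp at this

/-- A factor sees only its own vertex and its parents. This allows the support arguments below to
assemble a forbidden configuration from factors already known to be nonzero at other configurations.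
-/
lemma IsCPT.binConfig_congr {T : Set V} {D : Digraph V}
    {θ : ∀ a, (∀ b, BinRange T b) → BinRange T a → ℝ} (hθ : IsCPT D θ) {A B : Set V} {a : V}
    (ha : a ∈ A ↔ a ∈ B) (h : ∀ b ∈ T, D.Adj b a → (b ∈ A ↔ b ∈ B)) :
    θ a (binConfig T A) (binConfig T A a) = θ a (binConfig T B) (binConfig T B a) := by
  rw [hθ.parents a (binConfig T A) (binConfig T B)
    fun b hb => CausalDAG.binConfig_congr fun hT => h b hT hb,
    CausalDAG.binConfig_congr fun _ => ha]

open Classical in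
/-- The tables in which `b` is the function `g` of its parents, and the other vertices in `T` are
independent fair coins. -/
noncomputable def detCPT (T : Set V) (b : V) (g : (∀ a, BinRange T a) → Bool) (a : V)
    (x : ∀ a, BinRange T a) (s : BinRange T a) : ℝ :=
  if a = b then (if s.1 = g x then 1 else 0) else if a ∈ T then 1 / 2 else 1

lemma isCPT_detCPT {T : Set V} {b : V} (hb : b ∈ T) {g : (∀ a, BinRange T a) → Bool}
    {D : Digraph V} (hg : ∀ x y, (∀ a, D.Adj a b → x a = y a) → g x = g y) :
    IsCPT D (detCPT T b g) := by
  classical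
  have hsum : ∀ a ∈ T, ∀ f : Bool → ℝ, ∑ᶠ s : BinRange T a, f s.1 = f true + f false := by
    intro a ha f
    have h1 := finsum_comp_equiv (Equiv.subtypeUnivEquiv (p := fun s : Bool => s = true → a ∈ T)
      fun _ _ => ha) (f := f)
    refine Eq.trans h1 ?_
    rw [finsum_eq_sum_of_fintype]
    simp
  refine ⟨fun a x s => ?_, fun a x => ?_, fun a x y h => ?_⟩
  · unfold detCPT
    split_ifs <;> norm_num
  · unfold detCPT
    by_cases hab : a = b
    · subst hab
      simp only [if_true]
      rw [hsum a hb fun s => if s = g x then (1 : ℝ) else 0]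
      cases g x <;> simp
    · by_cases ha : a ∈ T
      · simp only [hab, ha, if_true, if_false]
        rw [hsum a ha fun _ => (1 / 2 : ℝ)]
        norm_num
      · simp only [hab, ha, if_false]
        have : Unique (BinRange T a) :=
          { default := ⟨false, by simp⟩
            uniq := fun t => Subtype.ext (by
              by_contra h
              exact ha (t.2 (by simpa using h))) }
        rw [finsum_unique]
  · funext s
    unfold detCPT
    by_cases hab : a = b
    · subst hab
      simp only [if_true, hg x y h]
    · simp only [hab, if_false]

lemma detCPT_ne_zero {T : Set V} {b : V} {g : (∀ a, BinRange T a) → Bool} {a : V}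
    {x : ∀ a, BinRange T a} {s : BinRange T a} :
    detCPT T b g a x s ≠ 0 ↔ (a = b → s.1 = g x) := by
  unfold detCPT
  split_ifs <;> simp_all

lemma detCPT_binConfig_ne_zero [Finite V] {T : Set V} {b : V} {g : (∀ a, BinRange T a) → Bool}
    {A J : Set V} {u : ∀ a, BinRange T a → ℝ} :
    interventional (detCPT T b g) J u (binConfig T A) ≠ 0 ↔
      (∀ a ∈ J, u a (binConfig T A a) ≠ 0) ∧
        (b ∉ J → (binConfig T A b).1 = g (binConfig T A)) := by
  rw [interventional_ne_zero]
  simp only [detCPT_ne_zero]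
  refine and_congr_right fun _ => ⟨fun h hb => h b hb rfl, ?_⟩
  rintro h a ha rfl
  exact h ha

/-- Equivalent DAGs have the same skeleton. -/
lemma MarkovEquiv.adj_or_adj [Finite V] {I : Set (Set V)} {D₁ D₂ : Digraph V}
    (h : MarkovEquiv I D₁ D₂) (hD₁ : IsDAG D₁) (hD₂ : IsDAG D₂) {a b : V} (hab : D₁.Adj a b) :
    D₂.Adj a b ∨ D₂.Adj b a := by
  by_contra! hn
  have hne : a ≠ b := by
    rintro rfl
    exact hD₁ a (.single hab)
  have haa : ∀ c, ¬ D₂.Adj c c := fun c hc => hD₂ c (.single hc)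
  set T : Set V := {a, b} with hT
  -- Here `b` copies the fair coin `a`, so the support is `x_a = x_b`. If `a` and `b` are not
  -- adjacent in `D₂`, the support is a product, and containing `∅` and `{a, b}` it also contains
  -- `{a}`.
  have hθ : IsCPT D₁ (detCPT T b fun x => (x a).1) :=
    isCPT_detCPT (by simp [hT]) fun x y hxy => by rw [hxy a hab]
  obtain ⟨u, hu⟩ := exists_isMarginals (BinRange T)
  obtain ⟨θ', hθ', hP⟩ := h.exists_cpt hθ hu
  obtain ⟨u', -, hP⟩ := hP ∅ (by simp)
  have key : ∀ A : Set V, (∀ c, θ' c (binConfig T A) (binConfig T A c) ≠ 0) ↔ (b ∈ A ↔ a ∈ A) := by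
    intro A
    have h1 := interventional_ne_zero θ' ∅ u' (binConfig T A)
    rw [← hP, detCPT_binConfig_ne_zero] at h1
    simp only [Set.mem_empty_iff_false, false_imp_iff, implies_true, true_and, not_false_eq_true,
      true_imp_iff] at h1
    rw [← h1]
    simp [binConfig, hT]
  have h1 := (key ∅).2 (by simp)
  have h2 := (key {a, b}).2 (by simp)
  have h3 := (key {a}).1 fun c => by
    by_cases hc : c ∈ T
    · rcases hc with rfl | rfl
      · rw [hθ'.binConfig_congr (B := {c, b})]
        · exact h2 c
        · simp
        · rintro d (rfl | rfl) hd
          · exact absurd hd (haa _)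
          · exact absurd hd hn.2
      · rw [hθ'.binConfig_congr (B := ∅)]
        · exact h1 c
        · simp [hne.symm]
        · rintro d (rfl | rfl) hd
          · exact absurd hd hn.1
          · exact absurd hd (haa _)
    · exact hθ'.binRange_ne_zero hc _ _
  simp [hne.symm] at h3

/-- Equivalent DAGs agree on the edges at a vertex that is intervened on. -/
lemma MarkovEquiv.adj_of_target [Finite V] {I : Set (Set V)} {D₁ D₂ : Digraph V}
    (h : MarkovEquiv I D₁ D₂) (hD₁ : IsDAG D₁) (hD₂ : IsDAG D₂) {a b : V} (haI : {a} ∈ I)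
    (hab : D₁.Adj a b) : D₂.Adj a b := by
  classical
  by_contra hn
  have hne : a ≠ b := by
    rintro rfl
    exact hD₁ a (.single hab)
  have haa : ∀ c, ¬ D₂.Adj c c := fun c hc => hD₂ c (.single hc)
  set T : Set V := {a, b} with hT
  have hθ : IsCPT D₁ (detCPT T b fun x => (x a).1) :=
    isCPT_detCPT (by simp [hT]) fun x y hxy => by rw [hxy a hab]
  -- Forcing `a` to be true forces its copy `b` to be true. If `a` is not a parent of `b` in `D₂`,
  -- the factor of `b` at false, nonzero observationally, is unaffected by the value of `a`, so the
  -- intervention would allow `{a}`.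
  set u : ∀ c, BinRange T c → ℝ := fun c s => if s = binConfig T T c then 1 else 0 with hu
  have hum : IsMarginals u := by
    refine ⟨fun c s => ?_, fun c => ?_⟩
    · simp only [hu]
      split_ifs <;> norm_num
    · rw [finsum_eq_sum_of_fintype]
      simp [hu]
  obtain ⟨θ', hθ', hP⟩ := h.exists_cpt hθ hum
  obtain ⟨u₀, -, hP₀⟩ := hP ∅ (by simp)
  obtain ⟨u₁, -, hP₁⟩ := hP {a} (by simp [haI])
  have key₀ : ∀ A : Set V, (∀ c, θ' c (binConfig T A) (binConfig T A c) ≠ 0) ↔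
      (b ∈ A ↔ a ∈ A) := by
    intro A
    have h1 := interventional_ne_zero θ' ∅ u₀ (binConfig T A)
    rw [← hP₀, detCPT_binConfig_ne_zero] at h1
    simp only [Set.mem_empty_iff_false, false_imp_iff, implies_true, true_and, not_false_eq_true,
      true_imp_iff] at h1
    rw [← h1]
    simp [binConfig, hT]
  have key₁ : ∀ A : Set V, (u₁ a (binConfig T A a) ≠ 0 ∧
      ∀ c, c ≠ a → θ' c (binConfig T A) (binConfig T A c) ≠ 0) ↔ (a ∈ A ∧ b ∈ A) := by
    intro A
    have h1 := interventional_ne_zero θ' {a} u₁ (binConfig T A)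
    rw [← hP₁, detCPT_binConfig_ne_zero] at h1
    simp only [Set.mem_singleton_iff, forall_eq] at h1
    rw [← h1]
    simp only [hu, binConfig, hT]
    simp [hne.symm]
    tauto
  have h1 := (key₀ ∅).2 (by simp)
  have h2 := (key₁ {a, b}).2 (by simp)
  have h3 := (key₁ {a}).1 ⟨by
    rw [binConfig_congr (B := {a, b}) (by simp)]
    exact h2.1, fun c hca => by
    by_cases hc : c ∈ T
    · obtain rfl : c = b := by
        rcases hc with rfl | rfl
        · exact absurd rfl hca
        · rfl
      rw [hθ'.binConfig_congr (B := ∅)]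
      · exact h1 c
      · simp [hne.symm]
      · rintro d (rfl | rfl) hd
        · exact absurd hd hn
        · exact absurd hd (haa _)
    · exact hθ'.binRange_ne_zero hc _ _⟩
  simp [hne.symm] at h3

/-- Equivalent DAGs have the same unshielded colliders. -/
lemma MarkovEquiv.collider [Finite V] {I : Set (Set V)} {D₁ D₂ : Digraph V}
    (h : MarkovEquiv I D₁ D₂) (hD₁ : IsDAG D₁) (hD₂ : IsDAG D₂) {a b c : V} (hac : a ≠ c)
    (hab : D₁.Adj a b) (hcb : D₁.Adj c b) (hac' : ¬ D₂.Adj a c) (hca' : ¬ D₂.Adj c a) :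
    D₂.Adj c b := by
  by_contra hn
  have hneab : a ≠ b := by
    rintro rfl
    exact hD₁ a (.single hab)
  have hnecb : c ≠ b := by
    rintro rfl
    exact hD₁ c (.single hcb)
  have haa : ∀ c, ¬ D₂.Adj c c := fun c hc => hD₂ c (.single hc)
  set T : Set V := {a, b, c} with hT
  -- With `b` the exclusive or of `a` and `c`, the support on `b = false` is `x_a = x_c`. Without `c
  -- → b` in `D₂`, the configuration `{c}` would be allowed as well: its factors at `a` and `b`
  -- agree with those of `∅`, its factor at `c` with that of `{a, c}`.
  have hθ : IsCPT D₁ (detCPT T b fun x => xor (x a).1 (x c).1) :=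
    isCPT_detCPT (by simp [hT]) fun x y hxy => by rw [hxy a hab, hxy c hcb]
  obtain ⟨u, hu⟩ := exists_isMarginals (BinRange T)
  obtain ⟨θ', hθ', hP⟩ := h.exists_cpt hθ hu
  obtain ⟨u', -, hP⟩ := hP ∅ (by simp)
  have key : ∀ A : Set V, b ∉ A → ((∀ d, θ' d (binConfig T A) (binConfig T A d) ≠ 0) ↔
      (a ∈ A ↔ c ∈ A)) := by
    intro A hbA
    have h1 := interventional_ne_zero θ' ∅ u' (binConfig T A)
    rw [← hP, detCPT_binConfig_ne_zero] at h1
    simp only [Set.mem_empty_iff_false, false_imp_iff, implies_true, true_and, not_false_eq_true,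
      true_imp_iff] at h1
    rw [← h1]
    by_cases haA : a ∈ A <;> by_cases hcA : c ∈ A <;> simp [binConfig, hT, hbA, haA, hcA]
  have h1 := (key ∅ (by simp)).2 (by simp)
  have h2 := (key {a, c} (by simp [hneab.symm, hnecb.symm])).2 (by simp)
  have h3 := (key {c} (by simp [hnecb.symm])).1 fun d => by
    by_cases hd : d ∈ T
    · rcases hd with rfl | rfl | rfl
      · rw [hθ'.binConfig_congr (B := ∅)]
        · exact h1 d
        · simp [hac]
        · rintro e (rfl | rfl | rfl) he
          · exact absurd he (haa _)
          · simp [hnecb.symm]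
          · exact absurd he hca'
      · rw [hθ'.binConfig_congr (B := ∅)]
        · exact h1 d
        · simp [hnecb.symm]
        · rintro e (rfl | rfl | rfl) he
          · simp [hac]
          · exact absurd he (haa _)
          · exact absurd he hn
      · rw [hθ'.binConfig_congr (B := {a, d})]
        · exact h2 d
        · simp
        · rintro e (rfl | rfl | rfl) he
          · exact absurd he hac'
          · simp [hneab.symm]
          · simp
    · exact hθ'.binRange_ne_zero hd _ _
  simp [hac] at h3

/-! ### Reversing covered edges -/

/-- An edge `a → b` is covered if `b` has the same parents as `a`, apart from `a`. -/
def Covered (D : Digraph V) (a b : V) : Prop :=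
  D.Adj a b ∧ ∀ q, q ≠ a → (D.Adj q b ↔ D.Adj q a)

/-- The graph with the edge `a → b` replaced by `b → a`. -/
def reverseEdge (D : Digraph V) (a b : V) : Digraph V where
  Adj x y := (D.Adj x y ∧ ¬ (x = a ∧ y = b)) ∨ (x = b ∧ y = a)

lemma IsDAG.irrefl {D : Digraph V} (hD : IsDAG D) (a : V) : ¬ D.Adj a a :=
  fun h => hD a (.single h)

lemma IsDAG.asymm {D : Digraph V} (hD : IsDAG D) {a b : V} (h : D.Adj a b) : ¬ D.Adj b a :=
  fun h' => hD a (.tail (.single h) h')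

lemma IsDAG.ne {D : Digraph V} (hD : IsDAG D) {a b : V} (h : D.Adj a b) : a ≠ b := by
  rintro rfl
  exact hD.irrefl a h

lemma IsDAG.induced {D : Digraph V} (hD : IsDAG D) (C : Set V) : IsDAG (induced D C) :=
  fun a h => hD a (h.lift (fun x : C => (x : V)) fun _ _ h => h)

/-- A cycle through the new edge yields a path from `a` to `b` avoiding the old edge. Its last step
comes from a parent `q ≠ a` of `b`, which is also a parent of `a`, so `D` already had a cycle. -/
lemma Covered.isDAG_reverseEdge {D : Digraph V} (hD : IsDAG D) {a b : V} (h : Covered D a b) :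
    IsDAG (reverseEdge D a b) := by
  set R : V → V → Prop := fun x y => D.Adj x y ∧ ¬ (x = a ∧ y = b)
  have hRD : ∀ {x y}, Relation.ReflTransGen R x y → Relation.ReflTransGen D.Adj x y :=
    fun h => h.lift id fun _ _ h => h.1
  have key : ∀ x y, Relation.TransGen (reverseEdge D a b).Adj x y →
      Relation.TransGen R x y ∨ (Relation.ReflTransGen R x b ∧ Relation.ReflTransGen R a y) := by
    intro x y hxy
    induction hxy with
    | single h =>
      rcases h with h | ⟨rfl, rfl⟩
      · exact .inl (.single h)
      · exact .inr ⟨.refl, .refl⟩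
    | tail _ h ih =>
      rcases h with h | ⟨rfl, rfl⟩
      · exact ih.imp (fun ih => ih.tail h) fun ih => ⟨ih.1, ih.2.tail h⟩
      · exact .inr ⟨ih.elim (fun ih => ih.to_reflTransGen) fun ih => ih.1, .refl⟩
  intro x hx
  rcases key x x hx with h' | ⟨h1, h2⟩
  · exact hD x (h'.lift id fun _ _ h => h.1)
  · rcases (h2.trans h1).cases_tail with hab | ⟨q, h3, h4⟩
    · exact hD.ne h.1 hab.symm
    · have hqa : q ≠ a := by
        rintro rfl
        exact h4.2 ⟨rfl, rfl⟩
      exact hD a (.tail' (hRD h3) ((h.2 q hqa).1 h4.1))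

lemma Covered.reverseEdge {D : Digraph V} (hD : IsDAG D) {a b : V} (h : Covered D a b) :
    Covered (reverseEdge D a b) b a := by
  have hab := hD.ne h.1
  refine ⟨.inr ⟨rfl, rfl⟩, fun q hq => ?_⟩
  by_cases hqa : q = a
  · subst hqa
    simp [CausalDAG.reverseEdge, hab, hD.irrefl]
  · simp [CausalDAG.reverseEdge, hq, hqa, h.2 q hqa]

lemma reverseEdge_reverseEdge {D : Digraph V} (hD : IsDAG D) {a b : V} (h : D.Adj a b) :
    reverseEdge (reverseEdge D a b) b a = D := by
  have hba := hD.asymm h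
  have hab := hD.ne h
  ext x y
  by_cases h1 : x = a ∧ y = b
  · obtain ⟨rfl, rfl⟩ := h1
    simp [reverseEdge, h]
  · by_cases h2 : x = b ∧ y = a
    · obtain ⟨rfl, rfl⟩ := h2
      simp [reverseEdge, hba, hab.symm]
    · simp only [reverseEdge, h1, h2, or_false, not_false_eq_true, and_true]

open Classical in
/-- The probability that `b` takes the value `s`, averaged over the values of its parent `a`. -/
noncomputable def averagedCPT {S : V → Type} (θ : ∀ a, (∀ b, S b) → S a → ℝ) (a b : V)
    (x : ∀ b, S b) (s : S b) : ℝ :=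
  ∑ᶠ t : S a, θ a x t * θ b (Function.update x a t) s

open Classical in
/-- The tables, after the reversal of `a → b`, of the same observational distribution. -/
noncomputable def reversedCPT {S : V → Type} (θ : ∀ a, (∀ b, S b) → S a → ℝ) (a b : V)
    (c : V) (x : ∀ b, S b) (s : S c) : ℝ :=
  if c = b then averagedCPT θ a c x s
  else if c = a then
    -- Bayes' formula; where the value of `b` has probability zero, any distribution would serve.
    if averagedCPT θ c b x (x b) = 0 then θ c x s
    else θ c x s * θ b (Function.update x c s) (x b) / averagedCPT θ c b x (x b)
  else θ c x s

/-- Once `a` is averaged out, `b` depends only on its other parents, and these are parents of `a`.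
-/
lemma Covered.averagedCPT_congr {D : Digraph V} {a b : V} (h : Covered D a b)
    {S : V → Type} {θ : ∀ a, (∀ b, S b) → S a → ℝ} (hθ : IsCPT D θ) {x y : ∀ b, S b}
    (hxy : ∀ q, D.Adj q a → x q = y q) : averagedCPT θ a b x = averagedCPT θ a b y := by
  classical
  funext s
  unfold averagedCPT
  refine finsum_congr fun t => ?_
  rw [hθ.parents a x y hxy, hθ.parents b (Function.update x a t) (Function.update y a t)]
  intro q hq
  by_cases hqa : q = a
  · subst hqa
    simp
  · simp [hqa, hxy q ((h.2 q hqa).1 hq)]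

lemma Covered.isCPT_reversedCPT {D : Digraph V} (hD : IsDAG D) {a b : V} (h : Covered D a b)
    {S : V → Type} [∀ a, Finite (S a)] {θ : ∀ a, (∀ b, S b) → S a → ℝ} (hθ : IsCPT D θ) :
    IsCPT (CausalDAG.reverseEdge D a b) (reversedCPT θ a b) := by
  classical
  have hab := hD.ne h.1
  have hnonneg : ∀ x s, 0 ≤ averagedCPT θ a b x s := fun x s =>
    finsum_nonneg fun t => mul_nonneg (hθ.nonneg _ _ _) (hθ.nonneg _ _ _)
  have : ∀ c, Fintype (S c) := fun c => Fintype.ofFinite _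
  refine ⟨fun c x s => ?_, fun c x => ?_, fun c x y hxy => ?_⟩
  · unfold reversedCPT
    split_ifs with h1 h2 h3
    · subst h1
      exact hnonneg x s
    · exact hθ.nonneg _ _ _
    · subst h2
      exact div_nonneg (mul_nonneg (hθ.nonneg _ _ _) (hθ.nonneg _ _ _)) (hnonneg _ _)
    · exact hθ.nonneg _ _ _
  · unfold reversedCPT
    by_cases h1 : c = b
    · subst h1
      simp only [if_true]
      unfold averagedCPT
      simp only [finsum_eq_sum_of_fintype]
      rw [Finset.sum_comm]
      have h2 : ∀ t, ∑ s, θ c (Function.update x a t) s = 1 := fun t => by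
        rw [← finsum_eq_sum_of_fintype]
        exact hθ.sum_eq_one _ _
      simp only [← Finset.mul_sum, h2, mul_one]
      rw [← finsum_eq_sum_of_fintype]
      exact hθ.sum_eq_one _ _
    · by_cases h2 : c = a
      · subst h2
        simp only [hab, if_true, if_false]
        split_ifs with h3
        · exact hθ.sum_eq_one _ _
        · rw [finsum_eq_sum_of_fintype, ← Finset.sum_div]
          rw [div_eq_one_iff_eq h3]
          unfold averagedCPT
          rw [finsum_eq_sum_of_fintype]
      · simp only [h1, h2, if_false]
        exact hθ.sum_eq_one _ _
  · funext s
    unfold reversedCPT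
    by_cases h1 : c = b
    · subst h1
      simp only [if_true]
      rw [h.averagedCPT_congr hθ]
      intro q hq
      have hqa := hD.ne hq
      exact hxy q (.inl ⟨(h.2 q hqa).2 hq, fun h => hqa h.1⟩)
    · by_cases h2 : c = a
      · subst h2
        simp only [hab, if_true, if_false]
        have hb : x b = y b := hxy b (.inr ⟨rfl, rfl⟩)
        have hq : ∀ q, D.Adj q c → x q = y q := fun q hq =>
          hxy q (.inl ⟨hq, fun h => hab h.2⟩)
        have h3 : θ b (Function.update x c s) = θ b (Function.update y c s) := by
          refine hθ.parents b _ _ fun q hqb => ?_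
          by_cases hqc : q = c
          · subst hqc
            simp
          · simp [hqc, hq q ((h.2 q hqc).1 hqb)]
        rw [h.averagedCPT_congr hθ hq, hθ.parents c x y hq, h3, hb]
      · simp only [h1, h2, if_false]
        rw [hθ.parents c x y fun q hq => hxy q (.inl ⟨hq, fun h => h1 h.2⟩)]

/-- The product of the factors of `a` and `b` is factored in the other order, and no other factor
changes. Both factors are present because neither vertex is intervened on. -/
lemma interventional_reversedCPT [Finite V] {a b : V} (hab : a ≠ b) {S : V → Type}
    [∀ a, Finite (S a)] {θ : ∀ a, (∀ b, S b) → S a → ℝ} (hθ : ∀ a x s, 0 ≤ θ a x s) {J : Set V}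
    (ha : a ∉ J) (hb : b ∉ J) (u : ∀ a, S a → ℝ) :
    interventional (reversedCPT θ a b) J u = interventional θ J u := by
  classical
  cases nonempty_fintype V
  have : ∀ c, Fintype (S c) := fun c => Fintype.ofFinite _
  funext x
  unfold interventional
  rw [finprod_eq_prod_of_fintype, finprod_eq_prod_of_fintype]
  rw [← Finset.mul_prod_erase _ _ (Finset.mem_univ a),
    ← Finset.mul_prod_erase _ _ (Finset.mem_erase.2 ⟨hab.symm, Finset.mem_univ b⟩),
    ← Finset.mul_prod_erase Finset.univ _ (Finset.mem_univ a),
    ← Finset.mul_prod_erase _ _ (Finset.mem_erase.2 ⟨hab.symm, Finset.mem_univ b⟩),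
    ← mul_assoc, ← mul_assoc]
  congr 1
  · simp only [ha, hb, if_false]
    have h1 : reversedCPT θ a b b x (x b) = averagedCPT θ a b x (x b) := by
      simp [reversedCPT]
    rw [h1]
    simp only [reversedCPT, hab, if_true, if_false, Function.update_eq_self]
    split_ifs with h0
    -- A vanishing average of nonnegative terms makes the original product vanish too.
    · have h2 : ∑ t, θ a x t * θ b (Function.update x a t) (x b) = 0 := by
        rw [← finsum_eq_sum_of_fintype]
        exact h0
      rw [Finset.sum_eq_zero_iff_of_nonneg
        fun t _ => mul_nonneg (hθ _ _ _) (hθ _ _ _)] at h2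
      have h3 := h2 (x a) (Finset.mem_univ _)
      rw [Function.update_eq_self] at h3
      rw [h0, h3, mul_zero]
    · rw [div_mul_cancel₀ _ h0]
  · refine Finset.prod_congr rfl fun c hc => ?_
    simp only [Finset.mem_erase] at hc
    simp [reversedCPT, hc.1, hc.2.1]

/-- Reversing a covered edge does not change the interventional model if no target contains an
end of it. -/
lemma Covered.markovEquiv [Finite V] {I : Set (Set V)} {D : Digraph V} (hD : IsDAG D) {a b : V}
    (h : Covered D a b) (ha : ∀ J ∈ I, a ∉ J) (hb : ∀ J ∈ I, b ∉ J) :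
    MarkovEquiv I D (CausalDAG.reverseEdge D a b) := by
  have key : ∀ {D : Digraph V} {a b : V}, IsDAG D → Covered D a b → (∀ J ∈ I, a ∉ J) →
      (∀ J ∈ I, b ∉ J) → ∀ (S : V → Type) [∀ a, Finite (S a)],
        interventionalModel S I D ⊆ interventionalModel S I (CausalDAG.reverseEdge D a b) := by
    rintro D a b hD h ha hb S _ P ⟨θ, hθ, hP⟩
    refine ⟨reversedCPT θ a b, h.isCPT_reversedCPT hD hθ, fun J hJ => ?_⟩
    obtain ⟨u, hu, hPJ⟩ := hP J hJ
    refine ⟨u, hu, ?_⟩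
    rw [hPJ, interventional_reversedCPT (hD.ne h.1) hθ.nonneg]
    · rcases hJ with rfl | hJ
      · simp
      · exact ha J hJ
    · rcases hJ with rfl | hJ
      · simp
      · exact hb J hJ
  intro S _ _
  refine (key hD h ha hb S).antisymm ?_
  have := key (h.isDAG_reverseEdge hD) (h.reverseEdge hD) hb ha S
  rwa [reverseEdge_reverseEdge hD h.1] at this

/-! ### DAGs without unshielded colliders -/

/-- No two parents of a vertex are non-adjacent. -/
def Moral (D : Digraph V) : Prop :=
  ∀ a b c, D.Adj a b → D.Adj c b → a ≠ c → D.Adj a c ∨ D.Adj c a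

/-- The graphs agree after the orientation of their edges is forgotten. -/
def SameSkeleton (D₁ D₂ : Digraph V) : Prop :=
  ∀ a b, D₁.Adj a b ∨ D₁.Adj b a ↔ D₂.Adj a b ∨ D₂.Adj b a

/-- The graphs have the same edges that start in a target. -/
def AgreeAtTargets (I : Set (Set V)) (D₁ D₂ : Digraph V) : Prop :=
  ∀ J ∈ I, ∀ a ∈ J, ∀ b, D₁.Adj a b ↔ D₂.Adj a b

lemma Moral.induced {D : Digraph V} (hD : Moral D) (C : Set V) : Moral (induced D C) :=
  fun a b c hab hcb hac => hD a b c hab hcb fun h => hac (Subtype.ext h)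

lemma SameSkeleton.induced {D₁ D₂ : Digraph V} (h : SameSkeleton D₁ D₂) (C : Set V) :
    SameSkeleton (induced D₁ C) (CausalDAG.induced D₂ C) :=
  fun a b => h a b

lemma MarkovEquiv.sameSkeleton [Finite V] {I : Set (Set V)} {D₁ D₂ : Digraph V}
    (h : MarkovEquiv I D₁ D₂) (hD₁ : IsDAG D₁) (hD₂ : IsDAG D₂) : SameSkeleton D₁ D₂ := by
  refine fun a b => ⟨fun hab => ?_, fun hab => ?_⟩
  · exact hab.elim (h.adj_or_adj hD₁ hD₂) fun hab => (h.adj_or_adj hD₁ hD₂ hab).symm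
  · exact hab.elim (h.symm.adj_or_adj hD₂ hD₁) fun hab => (h.symm.adj_or_adj hD₂ hD₁ hab).symm

lemma MarkovEquiv.moral [Finite V] {I : Set (Set V)} {D₁ D₂ : Digraph V}
    (h : MarkovEquiv I D₁ D₂) (hD₁ : IsDAG D₁) (hD₂ : IsDAG D₂) (hm : Moral D₁) : Moral D₂ := by
  intro a b c hab hcb hac
  by_contra hn
  have hn' := hn
  rw [← h.sameSkeleton hD₁ hD₂ a c] at hn'
  push Not at hn'
  have hcb' := h.symm.collider hD₂ hD₁ hac hab hcb hn'.1 hn'.2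
  have hab' := h.symm.collider hD₂ hD₁ hac.symm hcb hab hn'.2 hn'.1
  exact (hm a b c hab' hcb' hac).elim hn'.1 hn'.2

lemma MarkovEquiv.agreeAtTargets [Finite V] {I : Set (Set V)} {D₁ D₂ : Digraph V}
    (h : MarkovEquiv I D₁ D₂) (hD₁ : IsDAG D₁) (hD₂ : IsDAG D₂) (hI : ∀ J ∈ I, ∃ a, J = {a}) :
    AgreeAtTargets I D₁ D₂ := by
  intro J hJ a ha b
  obtain ⟨c, rfl⟩ := hI J hJ
  obtain rfl : a = c := ha
  exact ⟨h.adj_of_target hD₁ hD₂ hJ, h.symm.adj_of_target hD₂ hD₁ hJ⟩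

lemma IsDAG.wellFounded [Finite V] {D : Digraph V} (hD : IsDAG D) :
    WellFounded (Relation.TransGen D.Adj) := by
  have : Std.Irrefl (Relation.TransGen D.Adj) := ⟨hD⟩
  exact Finite.wellFounded_of_trans_of_irrefl _

lemma IsDAG.wellFounded_swap [Finite V] {D : Digraph V} (hD : IsDAG D) :
    WellFounded (Function.swap (Relation.TransGen D.Adj)) := by
  have : Std.Irrefl (Function.swap (Relation.TransGen D.Adj)) := ⟨hD⟩
  have : IsTrans V (Function.swap (Relation.TransGen D.Adj)) := ⟨fun _ _ _ h h' => h'.trans h⟩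
  exact Finite.wellFounded_of_trans_of_irrefl _

/-- Take `b` earliest in `D₁` among the heads of edges that `D₂` reverses, then `a` latest among the
tails of such edges into `b`. By the choice of `b`, both DAGs agree on edges into parents of `b`.
Morality of `D₁` makes any other parent of `b` adjacent to `a`, morality of `D₂` makes any parent of
`a` adjacent to `b`, and acyclicity together with the choice of `a` fixes the directions. -/
lemma exists_covered [Finite V] {D₁ D₂ : Digraph V} (hD₁ : IsDAG D₁) (hD₂ : IsDAG D₂)
    (hm₁ : Moral D₁) (hm₂ : Moral D₂) (hs : SameSkeleton D₁ D₂) {a₀ b₀ : V}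
    (h₁ : D₁.Adj a₀ b₀) (h₂ : D₂.Adj b₀ a₀) : ∃ a b, Covered D₁ a b ∧ D₂.Adj b a := by
  obtain ⟨b, ⟨a₁, ha₁⟩, hb⟩ := hD₁.wellFounded.has_min {b | ∃ a, D₁.Adj a b ∧ D₂.Adj b a}
    ⟨b₀, a₀, h₁, h₂⟩
  obtain ⟨a, ⟨hab, hba⟩, ha⟩ := hD₁.wellFounded_swap.has_min {a | D₁.Adj a b ∧ D₂.Adj b a}
    ⟨a₁, ha₁⟩
  have hpre : ∀ c, D₁.Adj c b → ∀ p, D₁.Adj p c → D₂.Adj p c := by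
    intro c hc p hp
    refine ((hs p c).1 (.inl hp)).resolve_right fun h => ?_
    exact hb c ⟨p, hp, h⟩ (.single hc)
  refine ⟨a, b, ⟨hab, fun q hq => ⟨fun hqb => ?_, fun hqa => ?_⟩⟩, hba⟩
  · refine (hm₁ q b a hqb hab hq).resolve_right fun haq => ?_
    have haq₂ := hpre q hqb a haq
    rcases (hs q b).1 (.inl hqb) with h | h
    · exact hD₂ a (((Relation.TransGen.single haq₂).tail h).tail hba)
    · exact ha q ⟨hqb, h⟩ (.single haq)
  · have hqa₂ := hpre a hab q hqa
    have hqb : q ≠ b := by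
      rintro rfl
      exact hD₁.asymm hab hqa
    refine ((hs q b).2 (hm₂ q a b hqa₂ hba hqb)).resolve_right fun hbq => ?_
    exact hD₁ a (((Relation.TransGen.single hab).tail hbq).tail hqa)

lemma Covered.sameSkeleton_reverseEdge {D : Digraph V} {a b : V} (h : Covered D a b) :
    SameSkeleton (CausalDAG.reverseEdge D a b) D := by
  intro x y
  have hab := h.1
  simp only [CausalDAG.reverseEdge]
  by_cases h1 : x = a ∧ y = b
  · obtain ⟨rfl, rfl⟩ := h1
    simp [hab]
  · by_cases h2 : x = b ∧ y = a
    · obtain ⟨rfl, rfl⟩ := h2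
      simp [hab]
    · have h3 : ¬ (y = a ∧ x = b) := fun h => h2 h.symm
      have h4 : ¬ (y = b ∧ x = a) := fun h => h1 h.symm
      simp only [h1, h2, h3, h4, or_false, not_false_eq_true, and_true]

/-- One gets from a moral DAG to another one with the same skeleton by reversals of covered edges
that are oriented differently in the latter. -/
theorem Moral.induction_on_covered [Finite V] {D₂ : Digraph V} (hD₂ : IsDAG D₂) (hm₂ : Moral D₂)
    (P : Digraph V → Prop)
    (step : ∀ E a b, IsDAG E → Covered E a b → D₂.Adj b a → P E → P (reverseEdge E a b))
    {D₁ : Digraph V} (hD₁ : IsDAG D₁) (hm₁ : Moral D₁) (hs : SameSkeleton D₁ D₂) (h : P D₁) :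
    P D₂ := by
  induction hn : {e : V × V | D₁.Adj e.1 e.2 ∧ D₂.Adj e.2 e.1}.ncard using Nat.strong_induction_on
    generalizing D₁ with
  | _ n ih =>
    by_cases hd : ∃ a₀ b₀, D₁.Adj a₀ b₀ ∧ D₂.Adj b₀ a₀
    · obtain ⟨a₀, b₀, h₁, h₂⟩ := hd
      obtain ⟨a, b, hab, hba⟩ := exists_covered hD₁ hD₂ hm₁ hm₂ hs h₁ h₂
      have hD := hab.isDAG_reverseEdge hD₁
      -- Observational equivalence serves only to transfer morality to the reversed DAG. The
      -- induction is on the number of edges on which the two DAGs disagree.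
      have hequiv := hab.markovEquiv (I := ∅) hD₁ (by simp) (by simp)
      refine ih _ ?_ hD (hequiv.moral hD₁ hD hm₁)
        (fun x y => (hab.sameSkeleton_reverseEdge x y).trans (hs x y))
        (step D₁ a b hD₁ hab hba h) rfl
      rw [← hn]
      refine Set.ncard_lt_ncard ⟨?_, fun hsub => ?_⟩
      · rintro ⟨x, y⟩ ⟨(h | ⟨rfl, rfl⟩), hyx⟩
        · exact ⟨h.1, hyx⟩
        · exact absurd hba (hD₂.asymm hyx)
      · rcases (hsub (a := (a, b)) ⟨hab.1, hba⟩).1 with h | h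
        · exact h.2 ⟨rfl, rfl⟩
        · exact hD₁.ne hab.1 h.1
    · push Not at hd
      have : D₁ = D₂ := by
        ext x y
        refine ⟨fun hxy => ((hs x y).1 (.inl hxy)).resolve_right (hd x y hxy), fun hxy => ?_⟩
        exact ((hs x y).2 (.inl hxy)).resolve_right fun hyx => hd y x hyx hxy
      rwa [← this]

/-- An edge that leaves a target in one DAG does so in the other, so an edge on which they disagree
has no end in a target and `Covered.markovEquiv` can apply to its reversal. -/
lemma AgreeAtTargets.notMem {I : Set (Set V)} {E D₂ : Digraph V} (hE : IsDAG E) (hD₂ : IsDAG D₂)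
    (h : AgreeAtTargets I E D₂) {a b : V} (hab : E.Adj a b) (hba : D₂.Adj b a) :
    (∀ J ∈ I, a ∉ J) ∧ ∀ J ∈ I, b ∉ J :=
  ⟨fun J hJ ha => hD₂.asymm hba ((h J hJ a ha b).1 hab),
    fun J hJ hb => hE.asymm hab ((h J hJ b hb a).2 hba)⟩

lemma AgreeAtTargets.reverseEdge {I : Set (Set V)} {E D₂ : Digraph V}
    (h : AgreeAtTargets I E D₂) {a b : V} (hab : (∀ J ∈ I, a ∉ J) ∧ ∀ J ∈ I, b ∉ J) :
    AgreeAtTargets I (CausalDAG.reverseEdge E a b) D₂ := by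
  intro J hJ x hx y
  have hxa : x ≠ a := by
    rintro rfl
    exact hab.1 J hJ hx
  have hxb : x ≠ b := by
    rintro rfl
    exact hab.2 J hJ hx
  simp [CausalDAG.reverseEdge, hxa, hxb, h J hJ x hx y]

/-- Moral DAGs with the same skeleton that agree at the targets are equivalent. -/
theorem Moral.markovEquiv [Finite V] {I : Set (Set V)} {D₁ D₂ : Digraph V} (hD₁ : IsDAG D₁)
    (hD₂ : IsDAG D₂) (hm₁ : Moral D₁) (hm₂ : Moral D₂) (hs : SameSkeleton D₁ D₂)
    (ht : AgreeAtTargets I D₁ D₂) : MarkovEquiv I D₁ D₂ := by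
  -- Agreement with `D₂` at the targets is carried along, since it keeps every reversed edge away
  -- from them.
  refine (Moral.induction_on_covered hD₂ hm₂
    (fun E => MarkovEquiv I D₁ E ∧ AgreeAtTargets I E D₂) ?_ hD₁ hm₁ hs ⟨.refl I D₁, ht⟩).1
  rintro E a b hE hab hba ⟨h, ht⟩
  have hI := ht.notMem hE hD₂ hab.1 hba
  exact ⟨h.trans (hab.markovEquiv hE hI.1 hI.2), ht.reverseEdge hI⟩

/-! ### Changing a DAG inside a set of vertices -/

open Classical in
/-- The graph `D` with its edges inside `C` replaced by those of `E`. -/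
def glue (D : Digraph V) (C : Set V) (E : Digraph C) : Digraph V where
  Adj x y := if h : x ∈ C ∧ y ∈ C then E.Adj ⟨x, h.1⟩ ⟨y, h.2⟩ else D.Adj x y

lemma glue_adj_coe {D : Digraph V} {C : Set V} {E : Digraph C} (x y : C) :
    (glue D C E).Adj x y ↔ E.Adj x y := by
  simp [glue]

lemma glue_adj_of_notMem {D : Digraph V} {C : Set V} {E : Digraph C} {x y : V}
    (h : ¬ (x ∈ C ∧ y ∈ C)) : (glue D C E).Adj x y ↔ D.Adj x y := by
  simp [glue, h]

lemma glue_induced (D : Digraph V) (C : Set V) : glue D C (induced D C) = D := by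
  ext x y
  simp [glue, induced]

lemma glue_reverseEdge (D : Digraph V) (C : Set V) (E : Digraph C) (a b : C) :
    glue D C (reverseEdge E a b) = reverseEdge (glue D C E) a b := by
  ext x y
  by_cases h : x ∈ C ∧ y ∈ C
  · obtain ⟨hx, hy⟩ := h
    lift x to C using hx
    lift y to C using hy
    rw [glue_adj_coe]
    simp only [reverseEdge, glue_adj_coe, Subtype.ext_iff]
  · have h1 : ¬ (x = a ∧ y = b) := by
      rintro ⟨rfl, rfl⟩
      exact h ⟨a.2, b.2⟩
    have h2 : ¬ (x = b ∧ y = a) := by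
      rintro ⟨rfl, rfl⟩
      exact h ⟨b.2, a.2⟩
    simp only [reverseEdge, glue_adj_of_notMem h, h1, h2, not_false_eq_true, and_true, or_false]

lemma Covered.glue {D : Digraph V} {C : Set V} {E : Digraph C}
    (hC : ∀ p ∉ C, ∀ x ∈ C, ∀ y ∈ C, D.Adj p x → D.Adj p y) {a b : C} (h : Covered E a b) :
    Covered (glue D C E) a b := by
  refine ⟨(glue_adj_coe a b).2 h.1, fun q hq => ?_⟩
  by_cases hqC : q ∈ C
  · lift q to C using hqC
    rw [glue_adj_coe, glue_adj_coe]
    exact h.2 q fun h => hq (congrArg _ h)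
  · rw [glue_adj_of_notMem fun h => hqC h.1, glue_adj_of_notMem fun h => hqC h.1]
    exact ⟨hC q hqC b b.2 a a.2, hC q hqC a a.2 b b.2⟩

/-- If the vertices in `C` have the same parents outside `C`, then an equivalent DAG can be
substituted for the induced one. -/
theorem Moral.markovEquiv_glue [Finite V] {I : Set (Set V)} {D : Digraph V} {C : Set V}
    (hC : ∀ p ∉ C, ∀ x ∈ C, ∀ y ∈ C, D.Adj p x → D.Adj p y) (hD : IsDAG D) (hm : Moral D)
    {E : Digraph C} (hE : IsDAG E) (hmE : Moral E) (hs : SameSkeleton (CausalDAG.induced D C) E)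
    (ht : AgreeAtTargets ((fun J : Set V => ((↑) ⁻¹' J : Set C)) '' I) (CausalDAG.induced D C) E) :
    IsDAG (glue D C E) ∧ MarkovEquiv I D (glue D C E) := by
  set I' := (fun J : Set V => ((↑) ⁻¹' J : Set C)) '' I
  -- The path of covered reversals from `D[C]` to `E` is lifted to the whole graph; acyclicity of
  -- the gluing comes along with it.
  have key := Moral.induction_on_covered hE hmE
    (fun F => (IsDAG (glue D C F) ∧ MarkovEquiv I D (glue D C F)) ∧ AgreeAtTargets I' F E)
    ?_ (hD.induced C) (hm.induced C) hs (by
      rw [glue_induced]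
      exact ⟨⟨hD, .refl I D⟩, ht⟩)
  · exact key.1
  rintro F a b hF hab hba ⟨⟨h1, h2⟩, ht⟩
  have hI := ht.notMem hF hE hab.1 hba
  have hcov : Covered (glue D C F) a b := hab.glue hC
  refine ⟨?_, ht.reverseEdge hI⟩
  rw [glue_reverseEdge]
  refine ⟨hcov.isDAG_reverseEdge h1, h2.trans (hcov.markovEquiv h1 ?_ ?_)⟩
  · exact fun J hJ => hI.1 _ ⟨J, hJ, rfl⟩
  · exact fun J hJ => hI.2 _ ⟨J, hJ, rfl⟩

/-! ### Essential graphs -/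

lemma essentialGraph_adj {I : Set (Set V)} {D : Digraph V} {a b : V} :
    (essentialGraph I D).Adj a b ↔ ∃ D', IsDAG D' ∧ MarkovEquiv I D D' ∧ D'.Adj a b := by
  simp [essentialGraph, and_assoc]

/-- The directed edges of the essential graph are the edges that are common to all the equivalent
DAGs. -/
lemma mem_dir_essentialGraph [Finite V] {I : Set (Set V)} {D : Digraph V} (hD : IsDAG D) {a b : V} :
    (a, b) ∈ Dir (essentialGraph I D) ↔
      D.Adj a b ∧ ∀ D', IsDAG D' → MarkovEquiv I D D' → ¬ D'.Adj b a := by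
  simp only [Dir, Set.mem_ofPred_eq, essentialGraph_adj]
  constructor
  · rintro ⟨⟨D', h1, h2, h3⟩, h⟩
    push Not at h
    refine ⟨?_, h⟩
    exact ((h2.sameSkeleton hD h1 a b).2 (.inl h3)).resolve_right fun hba => h D hD (.refl I D) hba
  · rintro ⟨h1, h2⟩
    refine ⟨⟨D, hD, .refl I D, h1⟩, ?_⟩
    push Not
    exact h2

/-- An unshielded collider is common to all equivalent DAGs, so its edges would be directed in the
essential graph. -/
lemma moral_of_essentialGraph_eq [Finite V] {G : SimpleGraph V} {D : Digraph V} (hD : IsDAG D)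
    (h : essentialGraph ∅ D = ofUndirected G) : Moral D := by
  intro a b c hab hcb hac
  by_contra hn
  push Not at hn
  have h1 : (essentialGraph ∅ D).Adj a b := essentialGraph_adj.2 ⟨D, hD, .refl _ D, hab⟩
  have h2 : (essentialGraph ∅ D).Adj b a := by
    rw [h] at h1 ⊢
    exact G.adj_symm h1
  obtain ⟨D', hD', hDD', hba⟩ := essentialGraph_adj.1 h2
  have hs := hDD'.sameSkeleton hD hD' c a
  have hn' : ¬ (D'.Adj c a ∨ D'.Adj a c) := fun h => (hs.2 h).elim hn.2 hn.1
  push Not at hn'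
  exact hD'.asymm hba (hDD'.collider hD hD' hac.symm hcb hab hn'.1 hn'.2)

/-- An equivalent DAG with `y → x` has the collider `p → x ← y`, so `p` and `y` are adjacent by
morality. If `D` had `y → p`, this direction would be common to all equivalent DAGs, and one with `x
→ y` would contain the cycle `p → x → y → p`. -/
lemma adj_of_undirected [Finite V] {I : Set (Set V)} {D : Digraph V} (hD : IsDAG D)
    (hm : Moral D) {p x y : V} (hpx : D.Adj p x) (hdir : ¬ (essentialGraph I D).Adj x p)
    (hxy : (essentialGraph I D).Adj x y) (hyx : (essentialGraph I D).Adj y x)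
    (hpy : p ≠ y) (hdir' : ¬ ((essentialGraph I D).Adj p y ∧ (essentialGraph I D).Adj y p)) :
    D.Adj p y := by
  obtain ⟨D₁, hD₁, hDD₁, hyx⟩ := essentialGraph_adj.1 hyx
  obtain ⟨D₂, hD₂, hDD₂, hxy⟩ := essentialGraph_adj.1 hxy
  have hpx' : ∀ D', IsDAG D' → MarkovEquiv I D D' → D'.Adj p x := fun D' hD' h =>
    ((h.sameSkeleton hD hD' p x).1 (.inl hpx)).resolve_right fun hxp =>
      hdir (essentialGraph_adj.2 ⟨D', hD', h, hxp⟩)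
  have hadj := hDD₁.moral hD hD₁ hm p x y (hpx' D₁ hD₁ hDD₁) hyx hpy
  refine ((hDD₁.sameSkeleton hD hD₁ p y).2 hadj).resolve_right fun hyp => ?_
  have hyp₂ : D₂.Adj y p := ((hDD₂.sameSkeleton hD hD₂ y p).1 (.inl hyp)).resolve_right fun h =>
    hdir' ⟨essentialGraph_adj.2 ⟨D₂, hD₂, hDD₂, h⟩, essentialGraph_adj.2 ⟨D, hD, .refl I D, hyp⟩⟩
  exact hD₂ p (((Relation.TransGen.single (hpx' D₂ hD₂ hDD₂)).tail hxy).tail hyp₂)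

/-- The vertices of a chain component have the same parents outside of it. -/
lemma adj_of_mem_chainComponents [Finite V] {I : Set (Set V)} {D : Digraph V} (hD : IsDAG D)
    (hm : Moral D) {C : Set V} (hC : C ∈ chainComponents (essentialGraph I D)) {p x y : V}
    (hp : p ∉ C) (hx : x ∈ C) (hy : y ∈ C) (hpx : D.Adj p x) : D.Adj p y := by
  obtain ⟨c, rfl⟩ := hC
  have hundir : ∀ y ∈ c.supp, ¬ ((essentialGraph I D).Adj p y ∧ (essentialGraph I D).Adj y p) := by
    rintro y hy h
    have hpy : (essentialGraph I D).toSimpleGraphStrict.Adj y p := ⟨fun h => hp (h ▸ hy), h.2, h.1⟩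
    exact hp ((c.mem_supp_congr_adj hpy).1 hy)
  obtain ⟨w⟩ : (essentialGraph I D).toSimpleGraphStrict.Reachable x y := c.reachable_of_mem_supp hx hy
  induction w with
  | nil => exact hpx
  | cons h w ih =>
    have hz := (c.mem_supp_congr_adj h).1 hx
    refine ih (adj_of_undirected hD hm hpx (fun h' => ?_) h.2.1 h.2.2 ?_ (hundir _ hz)) hz hy
    · exact hundir _ hx ⟨essentialGraph_adj.2 ⟨D, hD, .refl I D, hpx⟩, h'⟩
    · rintro rfl
      exact hp hz

end CausalDAG

/-! ### The decomposition along chain components -/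

theorem lemma2 {V : Type*} [Finite V] (G : SimpleGraph V) (hG : CausalDAG.IsChordal G)
    (D : Digraph V) (hD : CausalDAG.IsDAG D)
    (hGD : CausalDAG.essentialGraph ∅ D = CausalDAG.ofUndirected G)
    (k : ℕ) (v : Fin (k + 1) → V) :
    CausalDAG.Dir (CausalDAG.essentialGraph {J | ∃ i, J = {v i}} D) =
      CausalDAG.Dir (CausalDAG.essentialGraph {{v 0}} D) ∪
        ⋃ C ∈ CausalDAG.chainComponents (CausalDAG.essentialGraph {{v 0}} D),
          Prod.map (fun a : C => (a : V)) (fun a : C => (a : V)) ''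
            CausalDAG.Dir (CausalDAG.essentialGraph
              {J : Set C | ∃ i, ∃ h : v i ∈ C, J = {⟨v i, h⟩}} (CausalDAG.induced D C)) := by
  open CausalDAG in
  have hm := moral_of_essentialGraph_eq hD hGD
  ext ⟨a, b⟩
  simp only [Set.mem_union, Set.mem_iUnion]
  rw [mem_dir_essentialGraph hD]
  constructor
  · rintro ⟨hab, hdir⟩
    -- If the first target leaves the edge undirected, its ends share a chain component, and a
    -- reversal there would extend to `D` by gluing.
    by_cases hba : (essentialGraph {{v 0}} D).Adj b a
    · set H := (essentialGraph {{v 0}} D).toSimpleGraphStrict with hH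
      have hadj : H.Adj a b := ⟨hD.ne hab, essentialGraph_adj.2 ⟨D, hD, .refl _ D, hab⟩, hba⟩
      set C := (H.connectedComponentMk a).supp with hCdef
      have hC : C ∈ chainComponents (essentialGraph {{v 0}} D) := ⟨_, rfl⟩
      have haC : a ∈ C := rfl
      have hbC : b ∈ C := (SimpleGraph.ConnectedComponent.mem_supp_congr_adj _ hadj).1 haC
      refine .inr ⟨C, hC, (⟨a, haC⟩, ⟨b, hbC⟩), ?_, rfl⟩
      rw [mem_dir_essentialGraph (hD.induced C)]
      refine ⟨hab, fun E hE hDE hE' => ?_⟩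
      have hEt := hDE.agreeAtTargets (hD.induced C) hE (by
        rintro J ⟨i, h, rfl⟩
        exact ⟨_, rfl⟩)
      obtain ⟨h1, h2⟩ := Moral.markovEquiv_glue (I := {J | ∃ i, J = {v i}})
        (fun p hp x hx y hy => adj_of_mem_chainComponents hD hm hC hp hx hy) hD hm hE
        (hDE.moral (hD.induced C) hE (hm.induced C)) (hDE.sameSkeleton (hD.induced C) hE) (by
          rintro _ ⟨_, ⟨i, rfl⟩, rfl⟩ c (hc : (c : V) = v i) d
          exact hEt {c} ⟨i, hc ▸ c.2, congrArg _ (Subtype.ext hc)⟩ c rfl d)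
      exact hdir _ h1 h2 ((glue_adj_coe (D := D) ⟨b, hbC⟩ ⟨a, haC⟩).2 hE')
    · exact .inl ⟨essentialGraph_adj.2 ⟨D, hD, .refl _ D, hab⟩, hba⟩
  · rintro (h | ⟨C, -, ⟨a, b⟩, h, ⟨⟩⟩)
    · rw [mem_dir_essentialGraph hD] at h
      exact ⟨h.1, fun D' hD' hDD' => h.2 D' hD' (hDD'.mono (by
        rintro _ rfl
        exact ⟨0, rfl⟩))⟩
    · rw [mem_dir_essentialGraph (hD.induced C)] at h
      refine ⟨h.1, fun D' hD' hDD' hba => ?_⟩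
      have ht := hDD'.agreeAtTargets hD hD' (by
        rintro J ⟨i, rfl⟩
        exact ⟨_, rfl⟩)
      refine h.2 (induced D' C) (hD'.induced C) ?_ hba
      refine Moral.markovEquiv (hD.induced C) (hD'.induced C) (hm.induced C)
        ((hDD'.moral hD hD' hm).induced C) ((hDD'.sameSkeleton hD hD').induced C) ?_
      rintro _ ⟨i, hi, rfl⟩ c rfl d
      exact ht {v i} ⟨i, rfl⟩ (v i) rfl d
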